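/- **Notation.** For integers $0\le n\le p$, $0\le m\le q$ put $\mathbf O=(m,n,p,q)$ and $\mathbf P=(u,v,\mathbf c,\mathbf d,\mathbf C,\mathbf D)$ with $u,v\in\mathbb C$, $v\ne0$, $\mathbf c\in\mathbb C^p$, $\mathbf d\in\mathbb C^q$, $\mathbf C\in(0,\infty)^p$, $\mathbf D\in(0,\infty)^q$. Let $$\Phi(\zeta)=\frac{\prod_{j=1}^m\Gamma(d_j-D_j\zeta)\prod_{j=1}^n\Gamma(1-c_j+C_j\zeta)}{\prod_{j=n+1}^p\Gamma(c_j-C_j\zeta)\prod_{j=m+1}^q\Gamma(1-d_j+D_j\zeta)},\qquad H^{m,n}_{p,q}\Big[x\Big|{\mathbf c,\mathbf C\atop\mathbf d,\mathbf D}\Big]=\frac1{2\pi i}\int_{\mathcal L}\Phi(\zeta)x^\zeta d\zeta ,$$ and $H[x,\mathbf O,\mathbf P]=u\,H^{m,n}_{p,q}[vx\,|\,\mathbf c,\mathbf C;\mathbf d,\mathbf D]$. Here $x^\zeta$ is the principal power and $\mathcal L$ is a simple rectifiable curve from $\sigma-i\infty$ to $\sigma+i\infty$, equal to the line $\operatorname{Re}\zeta=\sigma$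 outside a bounded part, with the poles of $\Gamma(d_j-D_j\zeta)$, $j\le m$, on its right and those of $\Gamma(1-c_j+C_j\zeta)$, $j\le n$, on its left. The $H$ transform with kernel parameters $\mathbf O,\mathbf P$ is $$\mathbb H\{f,\mathbf O,\mathbf P\}(s)=u\int_0^\infty H^{m,n}_{p,q}\Big[vsz\Big|{\mathbf c,\mathbf C\atop\mathbf d,\mathbf D}\Big]f(z)\,dz ,$$ provided that this integral converges absolutely. For $(\mathbf O_j,\mathbf P_j)$, $j=1,\dots,N$, with functions $\Phi_j$ and contours $\mathcal L_j$, $$H^{0,1}_{1,0}\Big[{(1-\eta,\mathbf 1_N)\atop -}:(x_j,\mathbf O_j,\mathbf P_j)_{1,N}\Big]=\frac{u_1\cdots u_N}{(2\pi i)^N}\int_{\mathcal L_1}\!\!\cdots\!\int_{\mathcal L_N}\Gamma\Big(\eta+\sum_{j=1}^N\zeta_j\Big)\prod_{j=1}^N\Phi_j(\zeta_j)(v_jx_j)^{\zeta_j}\,d\zeta_1\cdots d\zeta_N .$$ **Lemma 1.** Let $s>0$, $\eta\ge0$, $\mathbf O_{R'}=(1,0,0,1)$ and $\mathbf P_{R'}=(s^{1-\eta},1,-,\eta-1,-,1)$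 (a dash stands for an empty list); for this kernel use any vertical line $\operatorname{Re}\zeta=\kappa$ with $\kappa<\eta-1$ as contour. Let $(\mathbf O_j,\mathbf P_j)$ and contours $\mathcal L_j$ as above, $j=1,\dots,N$, be such that the integrals defining $H[z,\mathbf O_j,\mathbf P_j]$ converge absolutely for all $z>0$, and $\operatorname{Re}(\eta+\zeta_1+\dots+\zeta_N)>0$ whenever $\zeta_j\in\mathcal L_j$ for all $j$. Then, with the contours $\mathcal L_j$ used for both sides, both sides of the following identity converge absolutely and $$\mathbb H\Big\{\prod_{j=1}^N H[z,\mathbf O_j,\mathbf P_j],\mathbf O_{R'},\mathbf P_{R'}\Big\}(s)=s^{-\eta}H^{0,1}_{1,0}\Big[{(1-\eta,\mathbf 1_N)\atop -}:\Big(\frac1s,\mathbf O_j,\mathbf P_j\Big)_{1,N}\Big].$$ In particular, for $N=1$, with $\mathbf O=(m,n,p,q)$ and $\mathbf P=(u,v,\mathbf c,\mathbf d,\mathbf C,\mathbf D)$ and the contour $\mathcal L$: this contour also separates the poles for the function $H^{m,n+1}_{p+1,q}$ below, whose integral converges absolutely, the right-hand side above is $s^{-\eta}$ times $u$ times this function,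 and $$\mathbb H\Big\{u\,H^{m,n}_{p,q}\Big[vz\Big|{\mathbf c,\mathbf C\atop\mathbf d,\mathbf D}\Big],\mathbf O_{R'},\mathbf P_{R'}\Big\}(s)=u\,s^{-\eta}\,H^{m,n+1}_{p+1,q}\Big[\frac vs\Big|{(1-\eta,\mathbf c),(1,\mathbf C)\atop\mathbf d,\mathbf D}\Big].$$ -/

import Mathlib

/-- A Mellin–Barnes contour in `ℂ`: a simple (injective) rectifiable curve, given by a Lipschitz
parametrization, that starts at `σ - i∞` and ends at `σ + i∞`. Outside a compact parameter range it
is the vertical line `Re z = σ`, traversed upwards; in between it may be indented. -/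
structure MBContour where
  /-- the parametrization -/
  toFun : ℝ → ℂ
  /-- the abscissa of the two vertical ends -/
  σ : ℝ
  lipschitz : ∃ K, LipschitzWith K toFun
  injective : Function.Injective toFun
  ends : ∃ T : ℝ, ∀ t : ℝ, T ≤ |t| → toFun t = (σ : ℂ) + (t : ℂ) * Complex.I

namespace MBContour

instance : CoeFun MBContour (fun _ => ℝ → ℂ) := ⟨MBContour.toFun⟩

/-- The upward vertical line `Re z = σ`. -/
noncomputable def vertical (σ : ℝ) : MBContour where
  toFun t := (σ : ℂ) + (t : ℂ) * Complex.I
  σ := σ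
  lipschitz := ⟨1, LipschitzWith.of_dist_le_mul fun x y => by
    rw [dist_add_left, dist_eq_norm, ← sub_mul, norm_mul, Complex.norm_I, mul_one,
      ← Complex.ofReal_sub, Complex.norm_real, Real.dist_eq, Real.norm_eq_abs, NNReal.coe_one,
      one_mul]⟩
  injective := fun x y h => by simpa using h
  ends := ⟨0, fun _ _ => rfl⟩

/-- The part of the plane to the left of the contour: the points that can be joined, without
meeting the contour, to every point of some half-plane `Re w < R`. -/
def leftSide (L : MBContour) : Set ℂ :=
  {z | ∃ R : ℝ, ∀ w : ℂ, w.re < R → JoinedIn (Set.range L)ᶜ z w}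

/-- The part of the plane to the right of the contour. -/
def rightSide (L : MBContour) : Set ℂ :=
  {z | ∃ R : ℝ, ∀ w : ℂ, R < w.re → JoinedIn (Set.range L)ᶜ z w}

end MBContour

/-- The order sequence `O = (m, n, p, q)` of a Fox `H` function, with `0 ≤ n ≤ p`, `0 ≤ m ≤ q`. -/
structure FoxOrder where
  m : ℕ
  n : ℕ
  p : ℕ
  q : ℕ
  n_le : n ≤ p
  m_le : m ≤ q

/-- The parameter sequence `P = (u, v, c, d, C, D)` of a Fox `H` function of order `O`. As usual
the `C_j` and `D_j` are positive and `v` is non-zero. -/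
structure FoxParam (O : FoxOrder) where
  u : ℂ
  v : ℂ
  c : Fin O.p → ℂ
  d : Fin O.q → ℂ
  C : Fin O.p → ℝ
  D : Fin O.q → ℝ
  v_ne : v ≠ 0
  C_pos : ∀ j, 0 < C j
  D_pos : ∀ j, 0 < D j

namespace FoxParam

variable {O : FoxOrder}

/-- The quotient of products of gamma functions
`Φ(z) = ∏_{j ≤ m} Γ(d_j - D_j z) ∏_{j ≤ n} Γ(1 - c_j + C_j z) /
  (∏_{n < j ≤ p} Γ(c_j - C_j z) ∏_{m < j ≤ q} Γ(1 - d_j + D_j z))`.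
(Indices start at `0` here. `Complex.Gamma` is `0` at its poles, so a pole of a factor of the
denominator makes the quotient `0`, as it should be.) -/
noncomputable def Phi (P : FoxParam O) (z : ℂ) : ℂ :=
  ((∏ j : Fin O.q with j.val < O.m, Complex.Gamma (P.d j - P.D j * z)) *
      ∏ j : Fin O.p with j.val < O.n, Complex.Gamma (1 - P.c j + P.C j * z)) /
    ((∏ j : Fin O.p with O.n ≤ j.val, Complex.Gamma (P.c j - P.C j * z)) *
      ∏ j : Fin O.q with O.m ≤ j.val, Complex.Gamma (1 - P.d j + P.D j * z))

/-- The contour separates the two families of poles: the poles `(d_j + k) / D_j` of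
`Γ(d_j - D_j z)`, `j ≤ m`, lie to its right, and the poles `(c_j - 1 - k) / C_j` of
`Γ(1 - c_j + C_j z)`, `j ≤ n`, lie to its left. -/
def Separates (P : FoxParam O) (L : MBContour) : Prop :=
  (∀ j : Fin O.q, (j : ℕ) < O.m → ∀ k : ℕ, (P.d j + k) / P.D j ∈ L.rightSide) ∧
    ∀ j : Fin O.p, (j : ℕ) < O.n → ∀ k : ℕ, (P.c j - 1 - k) / P.C j ∈ L.leftSide

/-- The integrand, with respect to the parameter `t` of the contour, of `∫_L Φ(z) x^z dz`. -/
noncomputable def integrand (P : FoxParam O) (L : MBContour) (x : ℂ) (t : ℝ) : ℂ :=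
  P.Phi (L t) * x ^ (L t) * deriv L t

/-- The Mellin–Barnes integral of `H^{m,n}_{p,q}[x | c, C; d, D]` along `L` converges
absolutely. -/
def Converges (P : FoxParam O) (L : MBContour) (x : ℂ) : Prop :=
  MeasureTheory.Integrable (P.integrand L x)

/-- `H^{m,n}_{p,q}[x | c, C; d, D] = (2πi)⁻¹ ∫_L Φ(z) x^z dz`, where `L` is the contour. The
factors `u`, `v` of `P` do not enter. -/
noncomputable def hFun (P : FoxParam O) (L : MBContour) (x : ℂ) : ℂ :=
  1 / (2 * Real.pi * Complex.I) * ∫ t : ℝ, P.integrand L x t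

/-- Fox's `H` function `H[s, O, P] = u H^{m,n}_{p,q}[v s | c, C; d, D]`. -/
noncomputable def foxH (P : FoxParam O) (L : MBContour) (s : ℂ) : ℂ :=
  P.u * P.hFun L (P.v * s)

/-- The integrand of the `H` transform of `f` at `s`, as a function on `(0, ∞)`. -/
noncomputable def hTransformIntegrand (P : FoxParam O) (L : MBContour) (f : ℝ → ℂ) (s z : ℝ) : ℂ :=
  P.hFun L (P.v * s * z) * f z

/-- The integral that defines the `H` transform of `f` at `s` converges absolutely. -/
def HTransformConverges (P : FoxParam O) (L : MBContour) (f : ℝ → ℂ) (s : ℝ) : Prop :=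
  MeasureTheory.IntegrableOn (P.hTransformIntegrand L f s) (Set.Ioi 0)

/-- The `H` transform with kernel parameters `O`, `P` (and contour `L` for the kernel):
`ℍ{f, O, P}(s) = u ∫_0^∞ H^{m,n}_{p,q}[v s z | c, C; d, D] f(z) dz`. -/
noncomputable def hTransform (P : FoxParam O) (L : MBContour) (f : ℝ → ℂ) (s : ℝ) : ℂ :=
  P.u * ∫ z : ℝ in Set.Ioi 0, P.hTransformIntegrand L f s z

end FoxParam

/-- The order `(m, n + 1, p + 1, q)`. -/
def FoxOrder.addUpper (O : FoxOrder) : FoxOrder where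
  m := O.m
  n := O.n + 1
  p := O.p + 1
  q := O.q
  n_le := Nat.succ_le_succ O.n_le
  m_le := O.m_le

/-- The parameters `(u, v, (a, c), d, (A, C), D)` of order `(m, n + 1, p + 1, q)`: the pair `(a, A)`
is put in front of the upper parameters. -/
def FoxParam.addUpper {O : FoxOrder} (P : FoxParam O) (a : ℂ) (A : ℝ) (hA : 0 < A) :
    FoxParam O.addUpper where
  u := P.u
  v := P.v
  c := (Fin.cons a P.c : Fin (O.p + 1) → ℂ)
  d := P.d
  C := (Fin.cons A P.C : Fin (O.p + 1) → ℝ)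
  D := P.D
  v_ne := P.v_ne
  C_pos := by
    change ∀ j : Fin (O.p + 1), 0 < (Fin.cons A P.C : Fin (O.p + 1) → ℝ) j
    exact Fin.cases hA P.C_pos
  D_pos := P.D_pos

/-- The order `(1, 0, 0, 1)`. -/
def rOrder : FoxOrder where
  m := 1
  n := 0
  p := 0
  q := 1
  n_le := le_rfl
  m_le := le_rfl

/-- The parameters `(s^{1-η}, 1, —, η - 1, —, 1)` of order `(1, 0, 0, 1)`. -/
noncomputable def rParam (η s : ℝ) : FoxParam rOrder where
  u := ((s ^ (1 - η) : ℝ) : ℂ)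
  v := 1
  c := Fin.elim0
  d := fun _ => (η : ℂ) - 1
  C := Fin.elim0
  D := fun _ => 1
  v_ne := one_ne_zero
  C_pos := fun j => Fin.elim0 j
  D_pos := fun _ => one_pos

/-- The outer parameters `(a_j; A_j^{(1)}, …, A_j^{(N)})_{1,p₀}`, `(b_j; B_j^{(1)}, …,
B_j^{(N)})_{1,q₀}` of a Fox `H` function `H^{0,n₀}_{p₀,q₀}` of `N` variables, `0 ≤ n₀ ≤ p₀`. -/
structure OuterParam (N : ℕ) where
  n₀ : ℕ
  p₀ : ℕ
  q₀ : ℕ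
  n₀_le : n₀ ≤ p₀
  a : Fin p₀ → ℂ
  A : Fin p₀ → Fin N → ℝ
  b : Fin q₀ → ℂ
  B : Fin q₀ → Fin N → ℝ
  A_pos : ∀ j l, 0 < A j l
  B_pos : ∀ j l, 0 < B j l

namespace OuterParam

variable {N : ℕ}

/-- `Ψ(ζ) = ∏_{j ≤ n₀} Γ(1 - a_j + ∑_l A_j^{(l)} ζ_l) / (∏_{n₀ < j ≤ p₀} Γ(a_j - ∑_l A_j^{(l)} ζ_l)
  ∏_{j ≤ q₀} Γ(1 - b_j + ∑_l B_j^{(l)} ζ_l))`. -/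
noncomputable def Psi (Q : OuterParam N) (ζ : Fin N → ℂ) : ℂ :=
  (∏ j : Fin Q.p₀ with j.val < Q.n₀, Complex.Gamma (1 - Q.a j + ∑ l, Q.A j l * ζ l)) /
    ((∏ j : Fin Q.p₀ with Q.n₀ ≤ j.val, Complex.Gamma (Q.a j - ∑ l, Q.A j l * ζ l)) *
      ∏ j : Fin Q.q₀, Complex.Gamma (1 - Q.b j + ∑ l, Q.B j l * ζ l))

/-- Suitable contours for the function of `N` variables: each `L_j` separates the two families of
poles of `Φ_j`, and, for every `j ≤ n₀`, the argument of `Γ(1 - a_j + ∑_l A_j^{(l)} ζ_l)` stays in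
the open right half-plane, so that the contours run to the right of the poles of this factor. -/
def Suitable (Q : OuterParam N) {O : Fin N → FoxOrder} (P : ∀ j, FoxParam (O j))
    (L : Fin N → MBContour) : Prop :=
  (∀ j, (P j).Separates (L j)) ∧
    ∀ j : Fin Q.p₀, (j : ℕ) < Q.n₀ → ∀ t : Fin N → ℝ,
      0 < (1 - Q.a j + ∑ l, Q.A j l * L l (t l)).re

/-- The integrand, with respect to the parameters `t_1, …, t_N` of the contours, of
`∫_{L_1} ⋯ ∫_{L_N} Ψ(ζ) ∏_j Φ_j(ζ_j) (v_j s_j)^{ζ_j} dζ_1 ⋯ dζ_N`. -/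
noncomputable def integrand (Q : OuterParam N) {O : Fin N → FoxOrder} (P : ∀ j, FoxParam (O j))
    (L : Fin N → MBContour) (s : Fin N → ℂ) (t : Fin N → ℝ) : ℂ :=
  Q.Psi (fun j => L j (t j)) * ∏ j, (P j).integrand (L j) ((P j).v * s j) (t j)

/-- The multiple Mellin–Barnes integral converges absolutely. -/
def Converges (Q : OuterParam N) {O : Fin N → FoxOrder} (P : ∀ j, FoxParam (O j))
    (L : Fin N → MBContour) (s : Fin N → ℂ) : Prop :=
  MeasureTheory.Integrable (Q.integrand P L s)

/-- The Fox `H` function of `N` variables `H^{0,n₀}_{p₀,q₀}[(a; A), (b; B) : (s_j, O_j, P_j)_{1,N}]`,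
with contours `L_1, …, L_N`. -/
noncomputable def multiH (Q : OuterParam N) {O : Fin N → FoxOrder} (P : ∀ j, FoxParam (O j))
    (L : Fin N → MBContour) (s : Fin N → ℂ) : ℂ :=
  (∏ j, (P j).u) / (2 * Real.pi * Complex.I) ^ N * ∫ t : Fin N → ℝ, Q.integrand P L s t

/-- The outer parameters `(1 - η; 1, …, 1)`, `—` of `H^{0,1}_{1,0}`. -/
noncomputable def oneSubEta (N : ℕ) (η : ℝ) : OuterParam N where
  n₀ := 1
  p₀ := 1
  q₀ := 0
  n₀_le := le_rfl
  a := fun _ => 1 - (η : ℂ)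
  A := fun _ _ => 1
  b := Fin.elim0
  B := Fin.elim0
  A_pos := fun _ _ => one_pos
  B_pos := fun j => Fin.elim0 j

end OuterParam

open MeasureTheory Set

/-! By the Cahen–Mellin integral the kernel H^{1,0}_{0,1}[x | (η-1, 1)] is x^{η-1} e^{-x}
(`rParam_hFun`). The prefactor s^{1-η} cancels the s^{η-1} in (sz)^{η-1}, so the transform of f is
the Laplace-type integral ∫_0^∞ z^{η-1} e^{-sz} f(z) dz. When f is a product of H functions written
as Mellin–Barnes integrals, z enters only through z^{ζ_1+…+ζ_N}. Integrating over z first therefore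
gives Γ(w) s^{-w} with w = η + ∑ ζ_j, which is the outer factor of the right-hand side.

The exchange is Fubini's theorem for `laplaceIntegrand`. The z-integral of its norm is Γ(Re w)
s^{-Re w} times the norm of a product of integrable functions of separate variables. The contours
are vertical outside a bounded part, so Re w stays in a compact subset of (0, ∞) and the factor is
bounded (`exists_bound_Gamma`). Fubini also gives the absolute convergence of both sides. For N = 1,
Γ(η + ζ) is one more upper numerator factor of Φ. -/

/-! ### Decay of the gamma function and the Cahen–Mellin integral. -/

theorem Complex.norm_Gamma_le_Gamma_re {w : ℂ} (hw : 0 < w.re) :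
    ‖Complex.Gamma w‖ ≤ Real.Gamma w.re := by
  rw [Complex.Gamma_eq_integral hw, Complex.GammaIntegral, Real.Gamma_eq_integral hw]
  refine (norm_integral_le_integral_norm _).trans_eq
    (setIntegral_congr_fun measurableSet_Ioi fun x hx => ?_)
  rw [norm_mul, Complex.norm_real, Real.norm_of_nonneg (Real.exp_pos _).le,
    Complex.norm_cpow_eq_rpow_re_of_pos hx, Complex.sub_re, Complex.one_re]

/-- The gamma function decays at least quadratically on vertical lines in the right half-plane. -/
theorem Complex.sq_mul_norm_Gamma_le {w : ℂ} (hw : 0 < w.re) :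
    ‖w‖ ^ 2 * ‖Complex.Gamma w‖ ≤ Real.Gamma (w.re + 2) := by
  have h0 : w ≠ 0 := fun h => by simp [h] at hw
  have h1 : w + 1 ≠ 0 := fun h => by
    have := congrArg Complex.re h
    simp at this
    linarith
  have h2 : ‖w‖ ≤ ‖w + 1‖ := by
    refine (sq_le_sq₀ (norm_nonneg _) (norm_nonneg _)).1 ?_
    rw [← Complex.normSq_eq_norm_sq, ← Complex.normSq_eq_norm_sq, Complex.normSq_apply,
      Complex.normSq_apply]
    simp
    nlinarith
  have h3 : Complex.Gamma (w + 2) = (w + 1) * (w * Complex.Gamma w) := by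
    rw [← Complex.Gamma_add_one _ h0, ← Complex.Gamma_add_one _ h1]
    ring_nf
  have h4 := Complex.norm_Gamma_le_Gamma_re (w := w + 2) (by simp; linarith)
  rw [h3, norm_mul, norm_mul] at h4
  have h5 : (w + 2).re = w.re + 2 := by simp
  rw [h5] at h4
  refine le_trans ?_ h4
  rw [sq, mul_assoc]
  gcongr

theorem Complex.continuousAt_Gamma_of_re_pos {w : ℂ} (hw : 0 < w.re) :
    ContinuousAt Complex.Gamma w := by
  refine (Complex.differentiableAt_Gamma w fun m h => ?_).continuousAt
  rw [h] at hw
  simp at hw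
  linarith [(Nat.cast_nonneg m : (0 : ℝ) ≤ m)]

/-- Quadratic decay dominates Γ on the line by a multiple of the rescaled Cauchy density. -/
theorem Complex.verticalIntegrable_Gamma {σ : ℝ} (hσ : 0 < σ) :
    Complex.VerticalIntegrable Complex.Gamma σ := by
  have hint : Integrable fun y : ℝ => Real.Gamma (σ + 2) * (σ ^ 2)⁻¹ * (1 + (y / σ) ^ 2)⁻¹ :=
    (integrable_inv_one_add_sq.comp_div hσ.ne').const_mul _
  refine hint.mono' (Continuous.aestronglyMeasurable ?_) (Filter.Eventually.of_forall fun y => ?_)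
  · refine continuous_iff_continuousAt.2 fun y => ContinuousAt.comp
      (Complex.continuousAt_Gamma_of_re_pos (by simpa using hσ)) (by fun_prop)
  · have h := Complex.sq_mul_norm_Gamma_le (w := σ + y * Complex.I) (by simpa using hσ)
    rw [← Complex.normSq_eq_norm_sq, Complex.normSq_apply] at h
    simp only [Complex.add_re, Complex.ofReal_re, Complex.mul_re, Complex.I_re, mul_zero,
      Complex.ofReal_im, Complex.I_im, mul_one, sub_self, add_zero, Complex.add_im,
      Complex.mul_im, zero_add] at h
    have h1 : 0 < σ * σ + y * y := by nlinarith [mul_self_nonneg y]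
    rw [mul_assoc, ← mul_inv, show σ ^ 2 * (1 + (y / σ) ^ 2) = σ * σ + y * y by field_simp,
      ← div_eq_mul_inv, le_div_iff₀ h1, mul_comm]
    exact h

/-- The Cahen–Mellin integral. -/
theorem mellinInv_Gamma {σ x : ℝ} (hσ : 0 < σ) (hx : 0 < x) :
    mellinInv σ Complex.Gamma x = Complex.exp (-x) := by
  have hre : ∀ y : ℝ, 0 < ((σ : ℂ) + y * Complex.I).re := fun y => by simpa using hσ
  have hmel : ∀ w : ℂ, 0 < w.re → mellin (fun t : ℝ => Complex.exp (-t)) w = Complex.Gamma w := by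
    intro w hw
    rw [Complex.Gamma_eq_integral hw, Complex.GammaIntegral_eq_mellin]
    simp
  have hconv : MellinConvergent (fun t : ℝ => Complex.exp (-t)) (σ : ℂ) := by
    have h := Complex.GammaIntegral_convergent (s := σ) (by simpa using hσ)
    refine h.congr_fun (fun t _ => ?_) measurableSet_Ioi
    simp [mul_comm]
  have hvert : Complex.VerticalIntegrable (mellin fun t : ℝ => Complex.exp (-t)) σ :=
    (Complex.verticalIntegrable_Gamma hσ).congr (Filter.Eventually.of_forall fun y =>
      (hmel _ (hre y)).symm)
  rw [← mellinInv_mellin_eq σ (fun t : ℝ => Complex.exp (-t)) hx hconv hvert (by fun_prop)]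
  simp only [mellinInv]
  congr 2
  ext y
  rw [hmel _ (hre y)]

/-! ### Complex powers and the kernel in closed form. -/

/-- A positive factor leaves the argument unchanged, so the principal logarithm is additive here
without a branch correction. -/
theorem Complex.mul_ofReal_cpow {v : ℂ} (hv : v ≠ 0) {r : ℝ} (hr : 0 < r) (w : ℂ) :
    (v * r) ^ w = v ^ w * (r : ℂ) ^ w := by
  have hr' : (r : ℂ) ≠ 0 := Complex.ofReal_ne_zero.2 hr.ne'
  rw [Complex.cpow_def_of_ne_zero (mul_ne_zero hv hr'), Complex.cpow_def_of_ne_zero hv,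
    Complex.cpow_def_of_ne_zero hr', mul_comm v, Complex.log_ofReal_mul hr hv,
    Complex.ofReal_log hr.le, ← Complex.exp_add]
  ring_nf

theorem Complex.prod_cpow {ι : Type*} {x : ℂ} (hx : x ≠ 0) (s : Finset ι) (f : ι → ℂ) :
    ∏ i ∈ s, x ^ f i = x ^ ∑ i ∈ s, f i := by
  simp only [Complex.cpow_def_of_ne_zero hx, ← Complex.exp_sum, Finset.mul_sum]

theorem FoxParam.integrand_mul_ofReal {O : FoxOrder} (P : FoxParam O) (L : MBContour) {r : ℝ}
    (hr : 0 < r) (t : ℝ) :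
    P.integrand L (P.v * r) t = (r : ℂ) ^ (L t) * P.integrand L P.v t := by
  simp only [FoxParam.integrand, Complex.mul_ofReal_cpow P.v_ne hr]
  ring

theorem rParam_Phi (η s : ℝ) (z : ℂ) : (rParam η s).Phi z = Complex.Gamma (η - 1 - z) := by
  change ((∏ j : Fin 1 with j.val < 1, Complex.Gamma ((η : ℂ) - 1 - (1 : ℝ) * z)) *
      ∏ j : Fin 0 with j.val < 0, Complex.Gamma (1 - Fin.elim0 j + (Fin.elim0 j : ℝ) * z)) /
    ((∏ j : Fin 0 with 0 ≤ j.val, Complex.Gamma (Fin.elim0 j - (Fin.elim0 j : ℝ) * z)) *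
      ∏ j : Fin 1 with 1 ≤ j.val, Complex.Gamma (1 - ((η : ℂ) - 1) + (1 : ℝ) * z)) = _
  simp

/-- The kernel is `H^{1,0}_{0,1}[x | (η - 1, 1)] = x^{η - 1} e^{-x}`. -/
theorem rParam_hFun {η s κ x : ℝ} (hκ : κ < η - 1) (hx : 0 < x) :
    (rParam η s).hFun (MBContour.vertical κ) x = (x : ℂ) ^ ((η : ℂ) - 1) * Complex.exp (-x) := by
  have hx' : (x : ℂ) ≠ 0 := Complex.ofReal_ne_zero.2 hx.ne'
  have hd : ∀ t : ℝ, deriv (fun t : ℝ => (κ : ℂ) + t * Complex.I) t = Complex.I := fun t => by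
    simpa using (((hasDerivAt_id t).ofReal_comp).mul_const Complex.I |>.const_add (κ : ℂ)).deriv
  -- The substitution w = η - 1 - ζ carries Re ζ = κ to Re w = η - 1 - κ > 0 and reverses the
  -- direction, hence the change t ↦ -t.
  rw [← mellinInv_Gamma (σ := η - 1 - κ) (by linarith) hx, mellinInv, FoxParam.hFun,
    ← integral_neg_eq_self]
  simp only [smul_eq_mul, Complex.real_smul]
  rw [mul_left_comm, ← integral_const_mul, ← integral_const_mul, ← integral_const_mul]
  congr 1
  ext t
  have h2 : (x : ℂ) ^ ((κ : ℂ) + ((-t : ℝ) : ℂ) * Complex.I) = (x : ℂ) ^ ((η : ℂ) - 1) *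
      (x : ℂ) ^ (-(((η - 1 - κ : ℝ) : ℂ) + t * Complex.I)) := by
    rw [← Complex.cpow_add _ _ hx']
    congr 1
    push_cast
    ring
  simp only [FoxParam.integrand, rParam_Phi, MBContour.vertical, hd, h2]
  have h3 : (η : ℂ) - 1 - ((κ : ℂ) + ((-t : ℝ) : ℂ) * Complex.I) =
      ((η - 1 - κ : ℝ) : ℂ) + t * Complex.I := by
    push_cast
    ring
  rw [h3]
  push_cast
  have := Complex.I_ne_zero
  have : (Real.pi : ℂ) ≠ 0 := Complex.ofReal_ne_zero.2 Real.pi_ne_zero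
  field_simp

/-! ### Geometry of contours and the added upper parameter. -/

theorem MBContour.continuous (L : MBContour) : Continuous L :=
  L.lipschitz.choose_spec.continuous

theorem MBContour.isCompact_range_re (L : MBContour) :
    IsCompact (range fun t => (L t).re) := by
  obtain ⟨T, hT⟩ := L.ends
  have h : (range fun t => (L t).re) = (fun t => (L t).re) '' Icc (-|T|) |T| := by
    refine Subset.antisymm ?_ (image_subset_range _ _)
    rintro _ ⟨t, rfl⟩
    rcases le_or_gt |t| |T| with ht | ht
    · exact ⟨t, abs_le.1 ht, rfl⟩
    -- On both vertical ends the real part is σ, a value already attained at |T|.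
    · refine ⟨|T|, ⟨by linarith [abs_nonneg T], le_rfl⟩, ?_⟩
      simp only
      rw [hT |T| (by rw [abs_abs]; exact le_abs_self T), hT t ((le_abs_self T).trans ht.le)]
      simp
  rw [h]
  exact isCompact_Icc.image (Complex.continuous_re.comp L.continuous)

theorem oneSubEta_Psi {N : ℕ} (η : ℝ) (ζ : Fin N → ℂ) :
    (OuterParam.oneSubEta N η).Psi ζ = Complex.Gamma (η + ∑ j, ζ j) := by
  change (∏ j : Fin 1 with j.val < 1, Complex.Gamma (1 - (1 - (η : ℂ)) + ∑ l, (1 : ℝ) * ζ l)) /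
    ((∏ j : Fin 1 with 1 ≤ j.val, Complex.Gamma ((1 - (η : ℂ)) - ∑ l, (1 : ℝ) * ζ l)) *
      ∏ j : Fin 0, Complex.Gamma (1 - Fin.elim0 j + ∑ l, (Fin.elim0 j : ℝ) * ζ l)) = _
  simp

theorem re_pos_of_suitable {N : ℕ} {η : ℝ} {O : Fin N → FoxOrder} {P : ∀ j, FoxParam (O j)}
    {L : Fin N → MBContour} (h : (OuterParam.oneSubEta N η).Suitable P L) (t : Fin N → ℝ) :
    0 < ((η : ℂ) + ∑ j, L j (t j)).re := by
  simpa [OuterParam.oneSubEta] using h.2 (0 : Fin 1) Nat.zero_lt_one t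

theorem addUpper_Phi {O : FoxOrder} (P : FoxParam O) (η : ℝ) (z : ℂ) :
    (P.addUpper (1 - η) 1 one_pos).Phi z = Complex.Gamma (η + z) * P.Phi z := by
  change ((∏ j : Fin O.q with j.val < O.m, Complex.Gamma (P.d j - P.D j * z)) *
      ∏ j : Fin (O.p + 1) with j.val < O.n + 1,
        Complex.Gamma (1 - (Fin.cons (1 - η : ℂ) P.c : Fin (O.p + 1) → ℂ) j +
          ((Fin.cons 1 P.C : Fin (O.p + 1) → ℝ) j : ℝ) * z)) /
    ((∏ j : Fin (O.p + 1) with O.n + 1 ≤ j.val,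
        Complex.Gamma ((Fin.cons (1 - η : ℂ) P.c : Fin (O.p + 1) → ℂ) j -
          ((Fin.cons 1 P.C : Fin (O.p + 1) → ℝ) j : ℝ) * z)) *
      ∏ j : Fin O.q with O.m ≤ j.val, Complex.Gamma (1 - P.d j + P.D j * z)) = _
  simp only [FoxParam.Phi, Finset.prod_filter]
  rw [Fin.prod_univ_succ, Fin.prod_univ_succ]
  simp
  ring

theorem addUpper_integrand {O : FoxOrder} (P : FoxParam O) (L : MBContour) (η : ℝ) (x : ℂ)
    (t : ℝ) : (P.addUpper (1 - η) 1 one_pos).integrand L x t =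
      Complex.Gamma (η + L t) * P.integrand L x t := by
  simp only [FoxParam.integrand, addUpper_Phi]
  ring

/-- The half-plane Re ≤ r is convex and misses the contour, so segments join its points. -/
theorem MBContour.mem_leftSide_of_forall_lt_re {L : MBContour} {r : ℝ} (h : ∀ t, r < (L t).re)
    {z : ℂ} (hz : z.re ≤ r) : z ∈ L.leftSide := by
  refine ⟨r, fun w hw => ?_⟩
  refine JoinedIn.of_segment_subset (((convex_halfSpace_re_le r).segment_subset hz hw.le).trans ?_)
  rintro y hy ⟨t, rfl⟩
  exact (h t).not_ge hy

/-- The new poles -η - k have real part at most -η, and the contour stays strictly to the right of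
that line. -/
theorem addUpper_separates {O : FoxOrder} {P : FoxParam O} {L : MBContour} {η : ℝ}
    (h : P.Separates L) (hL : ∀ t, 0 < η + (L t).re) :
    (P.addUpper (1 - η) 1 one_pos).Separates L := by
  refine ⟨h.1, ?_⟩
  change ∀ j : Fin (O.p + 1), (j : ℕ) < O.n + 1 → ∀ k : ℕ,
    ((Fin.cons (1 - η : ℂ) P.c : Fin (O.p + 1) → ℂ) j - 1 - k) /
      ((Fin.cons 1 P.C : Fin (O.p + 1) → ℝ) j : ℝ) ∈ L.leftSide
  refine Fin.cases (fun _ k => ?_) fun j hj k => ?_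
  · refine MBContour.mem_leftSide_of_forall_lt_re (r := -η) (fun t => by linarith [hL t]) ?_
    simp
  · simpa using h.2 j (by simpa using hj) k

/-! ### The double integral and Fubini's theorem. -/

/-- The integrand of the double integral whose two iterated integrals are the two sides of the
transform formula. -/
noncomputable def laplaceIntegrand {N : ℕ} {O : Fin N → FoxOrder} (P : ∀ j, FoxParam (O j))
    (L : Fin N → MBContour) (η s : ℝ) (x : ℝ × (Fin N → ℝ)) : ℂ :=
  (x.1 : ℂ) ^ ((η : ℂ) + ∑ j, L j (x.2 j) - 1) * Complex.exp (-(s * x.1)) *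
    ∏ j, (P j).integrand (L j) (P j).v (x.2 j)

section

variable {N : ℕ} {O : Fin N → FoxOrder} {P : ∀ j, FoxParam (O j)} {L : Fin N → MBContour}
  {η s : ℝ}

theorem integrable_prod_integrand
    (hconv : ∀ j, ∀ z : ℝ, 0 < z → (P j).Converges (L j) ((P j).v * z)) :
    Integrable fun t : Fin N → ℝ => ∏ j, (P j).integrand (L j) (P j).v (t j) :=
  Integrable.fintype_prod fun j => by
    simpa [FoxParam.Converges] using hconv j 1 one_pos

theorem norm_laplaceIntegrand {z : ℝ} (hz : 0 < z) (t : Fin N → ℝ) :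
    ‖laplaceIntegrand P L η s (z, t)‖ =
      z ^ (((η : ℂ) + ∑ j, L j (t j)).re - 1) * Real.exp (-(s * z)) *
        ‖∏ j, (P j).integrand (L j) (P j).v (t j)‖ := by
  rw [laplaceIntegrand, norm_mul, norm_mul, Complex.norm_cpow_eq_rpow_re_of_pos hz,
    Complex.norm_exp, Complex.sub_re, Complex.one_re]
  simp

theorem aestronglyMeasurable_laplaceIntegrand
    (hconv : ∀ j, ∀ z : ℝ, 0 < z → (P j).Converges (L j) ((P j).v * z)) :
    AEStronglyMeasurable (laplaceIntegrand P L η s)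
      ((volume.restrict (Ioi (0 : ℝ))).prod volume) := by
  refine AEStronglyMeasurable.mul (Measurable.aestronglyMeasurable ?_)
    (integrable_prod_integrand hconv).aestronglyMeasurable.comp_snd
  have h : ∀ j, Measurable fun x : ℝ × (Fin N → ℝ) => L j (x.2 j) := fun j =>
    (L j).continuous.measurable.comp (by fun_prop)
  fun_prop

/-- `Γ(η + ∑ Re ζ_j) s^{-(η + ∑ Re ζ_j)}` is bounded on the contours. -/
theorem exists_bound_Gamma (hs : 0 < s) (hsuit : (OuterParam.oneSubEta N η).Suitable P L) :
    ∃ M : ℝ, ∀ t : Fin N → ℝ,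
      ‖(1 / s) ^ ((η : ℂ) + ∑ j, L j (t j)).re * Real.Gamma ((η : ℂ) + ∑ j, L j (t j)).re‖ ≤ M := by
  have hK : IsCompact (univ.pi fun j => range fun t => (L j t).re) :=
    isCompact_univ_pi fun j => (L j).isCompact_range_re
  have hre : ∀ t : Fin N → ℝ, ((η : ℂ) + ∑ j, L j (t j)).re = η + ∑ j, (L j (t j)).re := by simp
  have hcont : ContinuousOn
      (fun y : Fin N → ℝ => (1 / s) ^ (η + ∑ j, y j) * Real.Gamma (η + ∑ j, y j))
      (univ.pi fun j => range fun t => (L j t).re) := by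
    intro y hy
    -- Each coordinate of y comes from its own contour parameter; suitability allows these to be
    -- chosen independently.
    choose t ht using fun j => hy j (mem_univ j)
    have hpos : 0 < η + ∑ j, y j := by
      have := re_pos_of_suitable hsuit t
      rw [hre] at this
      simpa only [← ht] using this
    have hlin : Continuous fun y : Fin N → ℝ => η + ∑ j, y j := by fun_prop
    refine ContinuousAt.continuousWithinAt (ContinuousAt.mul ?_ ?_)
    · exact (Real.continuousAt_const_rpow (by positivity)).comp hlin.continuousAt
    · refine ContinuousAt.comp (f := fun y : Fin N → ℝ => η + ∑ j, y j)
        (Real.differentiableAt_Gamma fun m h => ?_).continuousAt hlin.continuousAt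
      linarith [(Nat.cast_nonneg m : (0 : ℝ) ≤ m)]
  obtain ⟨M, hM⟩ := hK.exists_bound_of_continuousOn hcont
  refine ⟨M, fun t => ?_⟩
  rw [hre]
  exact hM (fun j => (L j (t j)).re) fun j _ => ⟨t j, rfl⟩

theorem integral_norm_laplaceIntegrand (hs : 0 < s)
    (hsuit : (OuterParam.oneSubEta N η).Suitable P L) (t : Fin N → ℝ) :
    ∫ z in Ioi (0 : ℝ), ‖laplaceIntegrand P L η s (z, t)‖ =
      (1 / s) ^ ((η : ℂ) + ∑ j, L j (t j)).re * Real.Gamma ((η : ℂ) + ∑ j, L j (t j)).re *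
        ‖∏ j, (P j).integrand (L j) (P j).v (t j)‖ := by
  rw [← Real.integral_rpow_mul_exp_neg_mul_Ioi (re_pos_of_suitable hsuit t) hs,
    ← integral_mul_const]
  exact setIntegral_congr_fun measurableSet_Ioi fun z hz => norm_laplaceIntegrand hz t

theorem integrable_laplaceIntegrand (hs : 0 < s)
    (hconv : ∀ j, ∀ z : ℝ, 0 < z → (P j).Converges (L j) ((P j).v * z))
    (hsuit : (OuterParam.oneSubEta N η).Suitable P L) :
    Integrable (laplaceIntegrand P L η s) ((volume.restrict (Ioi (0 : ℝ))).prod volume) := by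
  have hmeas := aestronglyMeasurable_laplaceIntegrand (η := η) (s := s) hconv
  refine (integrable_prod_iff' hmeas).2 ⟨?_, ?_⟩
  · filter_upwards with t
    have hpos := re_pos_of_suitable hsuit t
    simp only [laplaceIntegrand]
    refine Integrable.mul_const (f := fun z : ℝ => (z : ℂ) ^ ((η : ℂ) + ∑ j, L j (t j) - 1) *
      Complex.exp (-(s * z))) ?_ _
    -- A non-integrable function has integral 0 by convention, so a nonzero value of the integral
    -- proves integrability.
    have hne : ∫ z in Ioi (0 : ℝ), z ^ (((η : ℂ) + ∑ j, L j (t j)).re - 1) *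
        Real.exp (-(s * z)) ≠ 0 := by
      rw [Real.integral_rpow_mul_exp_neg_mul_Ioi hpos hs]
      exact mul_ne_zero (by positivity) (Real.Gamma_pos_of_pos hpos).ne'
    refine (not_imp_comm.1 integral_undef hne).mono'
      (Measurable.aestronglyMeasurable (by fun_prop)) ?_
    filter_upwards [ae_restrict_mem measurableSet_Ioi] with z hz
    rw [norm_mul, Complex.norm_cpow_eq_rpow_re_of_pos hz, Complex.norm_exp, Complex.sub_re,
      Complex.one_re]
    simp
  · obtain ⟨M, hM⟩ := exists_bound_Gamma hs hsuit
    have hm : AEStronglyMeasurable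
        (fun t => ∫ z in Ioi (0 : ℝ), ‖laplaceIntegrand P L η s (z, t)‖) volume :=
      hmeas.norm.prod_swap.integral_prod_right'
    refine ((integrable_prod_integrand hconv).norm.const_mul M).mono' hm ?_
    filter_upwards with t
    rw [integral_norm_laplaceIntegrand hs hsuit, norm_mul, norm_norm]
    gcongr
    exact hM t

theorem FoxParam.integrand_mul_one_div {O : FoxOrder} (P : FoxParam O) (L : MBContour) (hs : 0 < s)
    (t : ℝ) : P.integrand L (P.v * (1 / s)) t = ((1 / s : ℝ) : ℂ) ^ (L t) * P.integrand L P.v t := by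
  rw [← P.integrand_mul_ofReal L (one_div_pos.2 hs)]
  push_cast
  rfl

/-- Euler's integral gives Γ(w) (1/s)^w. Splitting w = η + ∑ ζ_j leaves s^{-η} outside and
distributes the powers (1/s)^{ζ_j} among the factors. -/
theorem integral_fst_laplaceIntegrand (hs : 0 < s)
    (hsuit : (OuterParam.oneSubEta N η).Suitable P L) (t : Fin N → ℝ) :
    ∫ z in Ioi (0 : ℝ), laplaceIntegrand P L η s (z, t) =
      ((s ^ (-η) : ℝ) : ℂ) * (OuterParam.oneSubEta N η).integrand P L (fun _ => 1 / (s : ℂ)) t := by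
  have hs' : (s : ℂ) ≠ 0 := Complex.ofReal_ne_zero.2 hs.ne'
  simp only [laplaceIntegrand]
  rw [integral_mul_const, Complex.integral_cpow_mul_exp_neg_mul_Ioi (re_pos_of_suitable hsuit t) hs,
    OuterParam.integrand, oneSubEta_Psi]
  simp only [FoxParam.integrand_mul_one_div _ _ hs, Finset.prod_mul_distrib]
  rw [Complex.prod_cpow (Complex.ofReal_ne_zero.2 (one_div_pos.2 hs).ne'),
    Complex.cpow_add _ _ (one_div_ne_zero hs'),
    Complex.ofReal_cpow hs.le, one_div, Complex.inv_cpow_ofReal_nonneg hs.le (η : ℂ),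
    ← Complex.cpow_neg]
  push_cast
  rw [one_div]
  ring

theorem integral_snd_laplaceIntegrand {z : ℝ} (hz : 0 < z) :
    ∫ t, laplaceIntegrand P L η s (z, t) = (z : ℂ) ^ ((η : ℂ) - 1) * Complex.exp (-(s * z)) *
      ∏ j, ∫ t, (P j).integrand (L j) ((P j).v * z) t := by
  have hz' : (z : ℂ) ≠ 0 := Complex.ofReal_ne_zero.2 hz.ne'
  rw [← integral_fintype_prod_volume_eq_prod, ← integral_const_mul]
  congr 1
  ext t
  simp only [laplaceIntegrand, FoxParam.integrand_mul_ofReal _ _ hz, Finset.prod_mul_distrib]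
  rw [Complex.prod_cpow hz', add_sub_right_comm, Complex.cpow_add _ _ hz']
  ring

theorem hTransformIntegrand_eq {κ : ℝ} (hs : 0 < s) (hκ : κ < η - 1) {z : ℝ} (hz : 0 < z) :
    (rParam η s).hTransformIntegrand (MBContour.vertical κ)
        (fun z => ∏ j, (P j).foxH (L j) z) s z =
      ((s ^ (η - 1) : ℝ) : ℂ) * ((∏ j, (P j).u) / (2 * Real.pi * Complex.I) ^ N) *
        ∫ t, laplaceIntegrand P L η s (z, t) := by
  have h : (rParam η s).v * s * z = ((s * z : ℝ) : ℂ) := by simp [rParam]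
  rw [integral_snd_laplaceIntegrand hz, FoxParam.hTransformIntegrand, h,
    rParam_hFun hκ (mul_pos hs hz), Complex.ofReal_mul, Complex.mul_cpow_ofReal_nonneg hs.le hz.le,
    Complex.ofReal_cpow hs.le]
  simp only [FoxParam.foxH, FoxParam.hFun, Finset.prod_mul_distrib, Finset.prod_const,
    Finset.card_univ, Fintype.card_fin, div_pow, one_pow]
  push_cast
  ring

theorem hTransformConverges_prod {κ : ℝ} (hs : 0 < s) (hκ : κ < η - 1)
    (hconv : ∀ j, ∀ z : ℝ, 0 < z → (P j).Converges (L j) ((P j).v * z))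
    (hsuit : (OuterParam.oneSubEta N η).Suitable P L) :
    (rParam η s).HTransformConverges (MBContour.vertical κ)
      (fun z => ∏ j, (P j).foxH (L j) z) s :=
  IntegrableOn.congr_fun
    ((integrable_laplaceIntegrand hs hconv hsuit).integral_prod_left.const_mul _)
    (fun _ hz => (hTransformIntegrand_eq hs hκ hz).symm) measurableSet_Ioi

theorem multiH_converges (hs : 0 < s)
    (hconv : ∀ j, ∀ z : ℝ, 0 < z → (P j).Converges (L j) ((P j).v * z))
    (hsuit : (OuterParam.oneSubEta N η).Suitable P L) :
    (OuterParam.oneSubEta N η).Converges P L (fun _ => 1 / (s : ℂ)) := by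
  have h := (integrable_laplaceIntegrand hs hconv hsuit).integral_prod_right
  simp only [integral_fst_laplaceIntegrand hs hsuit] at h
  -- Fubini gives integrability with the factor s^{-η}, which is nonzero and can be removed.
  exact (integrable_const_mul_iff (IsUnit.mk0 _ (Complex.ofReal_ne_zero.2
    (Real.rpow_pos_of_pos hs _).ne')) _).1 h

theorem hTransform_prod {κ : ℝ} (hs : 0 < s) (hκ : κ < η - 1)
    (hconv : ∀ j, ∀ z : ℝ, 0 < z → (P j).Converges (L j) ((P j).v * z))
    (hsuit : (OuterParam.oneSubEta N η).Suitable P L) :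
    (rParam η s).hTransform (MBContour.vertical κ) (fun z => ∏ j, (P j).foxH (L j) z) s =
      ((s ^ (-η) : ℝ) : ℂ) *
        (OuterParam.oneSubEta N η).multiH P L (fun _ => 1 / (s : ℂ)) := by
  have hu : (rParam η s).u * ((s ^ (η - 1) : ℝ) : ℂ) = 1 := by
    change ((s ^ (1 - η) : ℝ) : ℂ) * _ = 1
    rw [← Complex.ofReal_mul, ← Real.rpow_add hs]
    simp
  have hint : ∫ z in Ioi (0 : ℝ), ∫ t, laplaceIntegrand P L η s (z, t) =
      ∫ t, ∫ z in Ioi (0 : ℝ), laplaceIntegrand P L η s (z, t) :=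
    integral_integral_swap (f := fun z t => laplaceIntegrand P L η s (z, t))
      (integrable_laplaceIntegrand hs hconv hsuit)
  rw [FoxParam.hTransform, setIntegral_congr_fun measurableSet_Ioi
    fun z hz => hTransformIntegrand_eq hs hκ hz, integral_const_mul, hint]
  simp only [integral_fst_laplaceIntegrand hs hsuit]
  rw [integral_const_mul, OuterParam.multiH, ← mul_assoc, ← mul_assoc, ← mul_assoc,
    hu]
  ring

end

/-! ### The case N = 1 and the conclusion. -/

theorem oneSubEta_integrand_one {O : FoxOrder} (P : FoxParam O) (L : MBContour) (η s : ℝ)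
    (t : Fin 1 → ℝ) :
    (OuterParam.oneSubEta 1 η).integrand (fun _ => P) (fun _ => L) (fun _ => 1 / (s : ℂ)) t =
      (P.addUpper (1 - η) 1 one_pos).integrand L (P.v / s) (t 0) := by
  rw [OuterParam.integrand, oneSubEta_Psi, addUpper_integrand]
  simp [div_eq_mul_inv]

theorem addUpper_converges {O : FoxOrder} {P : FoxParam O} {L : MBContour} {η s : ℝ}
    (h : (OuterParam.oneSubEta 1 η).Converges (fun _ => P) (fun _ => L) (fun _ => 1 / (s : ℂ))) :
    (P.addUpper (1 - η) 1 one_pos).Converges L (P.v / s) := by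
  have h' : Integrable ((P.addUpper (1 - η) 1 one_pos).integrand L (P.v / s) ∘
      MeasurableEquiv.funUnique (Fin 1) ℝ) :=
    h.congr (Filter.Eventually.of_forall fun t => oneSubEta_integrand_one P L η s t)
  exact ((volume_preserving_funUnique (Fin 1) ℝ).integrable_comp_emb
    (MeasurableEquiv.measurableEmbedding _)).1 h'

theorem multiH_one {O : FoxOrder} (P : FoxParam O) (L : MBContour) (η s : ℝ) :
    (OuterParam.oneSubEta 1 η).multiH (fun _ : Fin 1 => P) (fun _ => L) (fun _ => 1 / (s : ℂ)) =
      P.u * (P.addUpper (1 - η) 1 one_pos).hFun L (P.v / s) := by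
  have h := (volume_preserving_funUnique (Fin 1) ℝ).integral_comp'
    ((P.addUpper (1 - η) 1 one_pos).integrand L (P.v / s))
  rw [OuterParam.multiH, FoxParam.hFun, ← h]
  simp only [oneSubEta_integrand_one, Fin.prod_univ_one, pow_one]
  rw [← mul_assoc, mul_one_div]
  rfl

/-- `κ` is the abscissa of a vertical contour for the kernel `H^{1,0}_{0,1}[· | (η - 1, 1)]` of the
transform: the condition `κ < η - 1` says that it has all the poles on its right. -/
theorem lemma1 (η s κ : ℝ) (hη : 0 ≤ η) (hs : 0 < s) (hκ : κ < η - 1) :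
    (∀ (N : ℕ) (O : Fin N → FoxOrder) (P : ∀ j, FoxParam (O j)) (L : Fin N → MBContour),
      (∀ j, ∀ z : ℝ, 0 < z → (P j).Converges (L j) ((P j).v * z)) →
      (OuterParam.oneSubEta N η).Suitable P L →
      (rParam η s).HTransformConverges (MBContour.vertical κ)
          (fun z => ∏ j, (P j).foxH (L j) z) s ∧
        (OuterParam.oneSubEta N η).Converges P L (fun _ => 1 / (s : ℂ)) ∧
        (rParam η s).hTransform (MBContour.vertical κ) (fun z => ∏ j, (P j).foxH (L j) z) s =
          ((s ^ (-η) : ℝ) : ℂ) *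
            (OuterParam.oneSubEta N η).multiH P L (fun _ => 1 / (s : ℂ))) ∧
    (∀ (O : FoxOrder) (P : FoxParam O) (L : MBContour),
      (∀ z : ℝ, 0 < z → P.Converges L (P.v * z)) →
      (OuterParam.oneSubEta 1 η).Suitable (fun _ => P) (fun _ => L) →
      (P.addUpper (1 - η) 1 one_pos).Separates L ∧
        (P.addUpper (1 - η) 1 one_pos).Converges L (P.v / s) ∧
        (OuterParam.oneSubEta 1 η).multiH (fun _ : Fin 1 => P) (fun _ => L) (fun _ => 1 / (s : ℂ)) =
          P.u * (P.addUpper (1 - η) 1 one_pos).hFun L (P.v / s) ∧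
        (rParam η s).HTransformConverges (MBContour.vertical κ)
          (fun z => P.u * P.hFun L (P.v * z)) s ∧
        (rParam η s).hTransform (MBContour.vertical κ) (fun z => P.u * P.hFun L (P.v * z)) s =
          P.u * ((s ^ (-η) : ℝ) : ℂ) * (P.addUpper (1 - η) 1 one_pos).hFun L (P.v / s)) := by

  refine ⟨fun N O P L hconv hsuit => ⟨hTransformConverges_prod hs hκ hconv hsuit,
    multiH_converges hs hconv hsuit, hTransform_prod hs hκ hconv hsuit⟩,
    fun O P L hconv hsuit => ?_⟩
  have hre : ∀ t, 0 < η + (L t).re := fun t => by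
    simpa using re_pos_of_suitable hsuit fun _ => t
  have hprod : (fun z : ℝ => P.u * P.hFun L (P.v * z)) = fun z : ℝ => ∏ _j : Fin 1, P.foxH L z := by
    ext z
    simp [FoxParam.foxH]
  refine ⟨addUpper_separates (hsuit.1 0) hre,
    addUpper_converges (multiH_converges hs (fun _ => hconv) hsuit), multiH_one P L η s, ?_, ?_⟩
  · rw [hprod]
    exact hTransformConverges_prod hs hκ (fun _ => hconv) hsuit
  · rw [hprod, hTransform_prod hs hκ (fun _ => hconv) hsuit, multiH_one]
    ring
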